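/- **Theorem (shape parameters from lambda lengths).** Work in hyperbolic 3-space $\mathbb H^3$, with boundary at infinity $\mathbb C\cup\{\infty\}$ in the upper half-space model, and identify $\mathrm{Isom}^+\mathbb H^3\cong PSL(2,\mathbb C)$. Let $\Delta$ be a (nondegenerate) ideal tetrahedron with ideal vertices numbered $0,1,2,3$ so that the vertices $0,3,2$ appear in anticlockwise order as seen from vertex $1$ (equivalently, some orientation-preserving isometry takes the vertices $0,1,2,3$ to $0,\infty,z,1$ respectively, with $\operatorname{Im} z>0$). *Shape parameters.* For an edge $ij$ of $\Delta$, the shape parameter $z_{ij}$ is the unique complex number with $\operatorname{Im} z_{ij}>0$ for which some orientation-preserving isometry places the endpoints of the edge at $0$ and $\infty$ and the remaining two ideal vertices at $1$ and $z_{ij}$. *Spin-decorated horospheres.* A frame is a right-handed orthonormal frame $(f_1,f_2,f_3)$ at a point of $\mathbb H^3$; a spin frame is a point of the double cover $\mathrm{Spin}\cong SL(2,\mathbb C)$ of the frame bundle $\mathrm{Fr}\cong PSL(2,\mathbb C)$. On a horosphere $\mathcal h$ let $N^{out}$ and $N^{in}=-N^{out}$ be the unit normals pointing towards and away from its centre.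 A spin decoration on $\mathcal h$ is a pair $W=(W^{in},W^{out})$ of continuous lifts to $\mathrm{Spin}$ of the frame fields $(N^{in},\mathcal V,N^{in}\times\mathcal V)$ and $(N^{out},\mathcal V,N^{out}\times\mathcal V)$, for a unit tangent vector field $\mathcal V$ on $\mathcal h$ that is parallel (invariant under the parabolic isometries preserving $\mathcal h$), such that $W^{in}$ is obtained from $W^{out}$ by rotation of angle $\pi$ about $\mathcal V$. *Lambda lengths.* For spin-decorated horospheres $(\mathcal h_1,W_1),(\mathcal h_2,W_2)$ with distinct centres, let $\gamma$ be the geodesic oriented from the centre of $\mathcal h_1$ to that of $\mathcal h_2$ and $q_i=\gamma\cap\mathcal h_i$. Let $d=\rho+i\theta$ (well defined modulo $4\pi i$) be such that translation along $\gamma$ by signed distance $\rho$ followed by rotation about $\gamma$ by angle $\theta$ takes the spin frame $W_1^{in}(q_1)$ to the spin frame $W_2^{out}(q_2)$. The complex lambda length from $(\mathcal h_1,W_1)$ to $(\mathcal h_2,W_2)$ is $\exp(d/2)$; it is $0$ if the centres coincide. Choose any spin-decorated horosphere $(\mathcal h_i,W_i)$ centred at the ideal vertex $i$, for $i=0,1,2,3$,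 and let $\lambda_{ij}$ be the complex lambda length from $(\mathcal h_i,W_i)$ to $(\mathcal h_j,W_j)$. Then all six shape parameters exist, are unique, and are given by $$z_{01}=z_{23}=\frac{\lambda_{02}\lambda_{13}}{\lambda_{03}\lambda_{12}},\qquad z_{02}=z_{13}=-\frac{\lambda_{03}\lambda_{12}}{\lambda_{01}\lambda_{23}},\qquad z_{03}=z_{12}=\frac{\lambda_{01}\lambda_{23}}{\lambda_{02}\lambda_{13}}.$$ -/

import Mathlib

namespace SpinHorosphere

open Matrix

/-- The group of spin isometries of hyperbolic 3-space, the double (universal) cover of the group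
`PSL(2, ℂ)` of orientation-preserving isometries. -/
abbrev SL2 : Type := Matrix.SpecialLinearGroup (Fin 2) ℂ

/-! ### Minkowski space, the hyperboloid model and its boundary -/

/-- Minkowski space `ℝ^{1,3}`, with coordinates `(T, X, Y, Z)` numbered `0, 1, 2, 3`. -/
abbrev Mink : Type := Fin 4 → ℝ

/-- The Minkowski inner product `T T' - X X' - Y Y' - Z Z'`. -/
def mink (u v : Mink) : ℝ := u 0 * v 0 - u 1 * v 1 - u 2 * v 2 - u 3 * v 3

/-- The Hermitian matrix with Minkowski coordinates `(T, X, Y, Z)`. -/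
noncomputable def toHerm (v : Mink) : Matrix (Fin 2) (Fin 2) ℂ :=
  (1 / 2 : ℂ) • !![(v 0 : ℂ) + v 3, v 1 + v 2 * Complex.I; v 1 - v 2 * Complex.I, v 0 - v 3]

/-- The Minkowski coordinates of a Hermitian matrix. -/
def ofHerm (S : Matrix (Fin 2) (Fin 2) ℂ) : Mink :=
  ![(S 0 0 + S 1 1).re, 2 * (S 0 1).re, 2 * (S 0 1).im, (S 0 0 - S 1 1).re]

/-- The linear action of `SL(2, ℂ)` on Minkowski space, `S ↦ A S A*` on Hermitian matrices. -/
noncomputable def act (A : SL2) (v : Mink) : Mink :=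
  ofHerm ((A : Matrix (Fin 2) (Fin 2) ℂ) * toHerm v * (A : Matrix (Fin 2) (Fin 2) ℂ)ᴴ)

/-- The hyperboloid model of hyperbolic 3-space. -/
def hyperboloid : Set Mink := {x | mink x x = 1 ∧ 0 < x 0}

/-- The positive light cone `L⁺`. -/
def lightCone : Set Mink := {p | mink p p = 0 ∧ 0 < p 0}

/-- The horosphere cut out of the hyperboloid by the lightlike plane `⟨x, p⟩ = 1`, for `p ∈ L⁺`.
Every horosphere is of this form for exactly one `p ∈ L⁺`. -/
def horosphere (p : Mink) : Set Mink := {x | x ∈ hyperboloid ∧ mink x p = 1}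

open Classical in
/-- The point of `∂𝕌 = ℂ ∪ {∞}` (boundary at infinity of the upper half space model) represented
by the ray of the light cone through `p`: `(X + iY) / (T - Z)`, the stereographic projection of
`(X/T, Y/T, Z/T)`. -/
noncomputable def boundaryPoint (p : Mink) : OnePoint ℂ :=
  if p 0 = p 3 then OnePoint.infty
  else (((p 1 + p 2 * Complex.I) / (p 0 - p 3) : ℂ) : OnePoint ℂ)

/-- The point of the light cone with `T = 1` on the ray representing a point of `∂𝕌`; its
coordinates `(X, Y, Z)` are the corresponding point of the unit sphere, which is the boundary of
the ball models. -/
noncomputable def celestial : OnePoint ℂ → Mink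
  | none => ![1, 0, 0, 1]
  | some z => ![1, 2 * z.re / (1 + Complex.normSq z), 2 * z.im / (1 + Complex.normSq z),
      (Complex.normSq z - 1) / (1 + Complex.normSq z)]

/-- The action of orientation-preserving isometries on `∂𝕌 = ℂ ∪ {∞}` by Möbius
transformations. -/
noncomputable def moebius (A : SL2) (x : OnePoint ℂ) : OnePoint ℂ :=
  (A : Matrix.GeneralLinearGroup (Fin 2) ℂ) • x

/-- The geodesic in the hyperboloid whose endpoints at infinity are the rays through `p` and
`q`. -/
def geodesic (p q : Mink) : Set Mink := {x | x ∈ hyperboloid ∧ ∃ a b : ℝ, x = a • p + b • q}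

/-! ### Frames and spin frames -/

/-- A (right-handed orthonormal) frame `(e1, e2, e3)` at a point `pos` of the hyperboloid. Tangent
vectors at `x` are the vectors orthogonal to `x`, and the Riemannian metric is the restriction of
`-⟨·, ·⟩`. -/
@[ext] structure Frame where
  pos : Mink
  e1 : Mink
  e2 : Mink
  e3 : Mink
  pos_mem : pos ∈ hyperboloid
  tangent1 : mink pos e1 = 0
  tangent2 : mink pos e2 = 0
  tangent3 : mink pos e3 = 0
  unit1 : mink e1 e1 = -1
  unit2 : mink e2 e2 = -1
  unit3 : mink e3 e3 = -1
  orth12 : mink e1 e2 = 0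
  orth13 : mink e1 e3 = 0
  orth23 : mink e2 e3 = 0
  rightHanded : 0 < (Matrix.of ![pos, e1, e2, e3]).det

theorem det_parts (A : SL2) :
    ((A 0 0).re * (A 1 1).re - (A 0 0).im * (A 1 1).im
      - ((A 0 1).re * (A 1 0).re - (A 0 1).im * (A 1 0).im) = 1) ∧
    ((A 0 0).re * (A 1 1).im + (A 0 0).im * (A 1 1).re
      - ((A 0 1).re * (A 1 0).im + (A 0 1).im * (A 1 0).re) = 0) := by
  have hA := A.det_coe
  rw [Matrix.det_fin_two] at hA
  have h1 := congrArg Complex.re hA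
  have h2 := congrArg Complex.im hA
  simp only [Complex.sub_re, Complex.mul_re, Complex.one_re, Complex.sub_im, Complex.mul_im,
    Complex.one_im] at h1 h2
  exact ⟨h1, h2⟩

theorem mink_act (A : SL2) (u v : Mink) : mink (act A u) (act A v) = mink u v := by
  obtain ⟨h1, h2⟩ := det_parts A
  simp [act, ofHerm, toHerm, mink, Matrix.mul_apply, Fin.sum_univ_two]
  generalize (A 0 0).re = a at *
  generalize (A 0 0).im = a' at *
  generalize (A 0 1).re = b at *
  generalize (A 0 1).im = b' at *
  generalize (A 1 0).re = c at *
  generalize (A 1 0).im = c' at *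
  generalize (A 1 1).re = d at *
  generalize (A 1 1).im = d' at *
  linear_combination (u 0 * v 0 - u 1 * v 1 - u 2 * v 2 - u 3 * v 3) *
    ((a * d - a' * d' - (b * c - b' * c') + 1) * h1 + (a * d' + a' * d - (b * c' + b' * c)) * h2)

theorem act_zero_pos (A : SL2) : 0 < act A ![1, 0, 0, 0] 0 := by
  obtain ⟨h1, h2⟩ := det_parts A
  simp [act, ofHerm, toHerm, Matrix.mul_apply, Fin.sum_univ_two]
  generalize (A 0 0).re = a at *
  generalize (A 0 0).im = a' at *
  generalize (A 0 1).re = b at *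
  generalize (A 0 1).im = b' at *
  generalize (A 1 0).re = c at *
  generalize (A 1 0).im = c' at *
  generalize (A 1 1).re = d at *
  generalize (A 1 1).im = d' at *
  nlinarith [sq_nonneg (a - d), sq_nonneg (b + c), sq_nonneg (a' + d'),
    sq_nonneg (b' - c'), sq_nonneg a']

theorem det_act (A : SL2) :
    (Matrix.of ![act A ![1, 0, 0, 0], act A ![0, 0, 0, 1], act A ![0, 0, 1, 0],
      act A ![0, -1, 0, 0]]).det = 1 := by
  obtain ⟨h1, h2⟩ := det_parts A
  simp [act, ofHerm, toHerm, Matrix.mul_apply, Matrix.det_succ_row_zero, Fin.sum_univ_succ,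
    Fin.succAbove]
  generalize (A 0 0).re = a at *
  generalize (A 0 0).im = a' at *
  generalize (A 0 1).re = b at *
  generalize (A 0 1).im = b' at *
  generalize (A 1 0).re = c at *
  generalize (A 1 0).im = c' at *
  generalize (A 1 1).re = d at *
  generalize (A 1 1).im = d' at *
  trans ((a * d - a' * d' - (b * c - b' * c'))^2 + (a * d' + a' * d - (b * c' + b' * c))^2)^2
  · ring
  · rw [h1, h2]; norm_num

/-- A spin frame is a point of the double cover `Spin → Fr` of the frame bundle of hyperbolic
3-space. The frame bundle is `PSL(2, ℂ)`, acting simply transitively on frames, and its double and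
universal cover is realised by `SL(2, ℂ)` with the covering map `SpinFrame.frame`. -/
abbrev SpinFrame : Type := SL2

/-- The covering map `Spin → Fr`: the spin frame `A` lies over the image under the isometry `A` of
the base frame `(∂_Z, ∂_Y, -∂_X)` at `(1, 0, 0, 0)`, which is the frame `(e_z, e_y, -e_x)` at the
point `(0, 0, 1)` of the upper half space. -/
noncomputable def SpinFrame.frame (A : SpinFrame) : Frame where
  pos := act A ![1, 0, 0, 0]
  e1 := act A ![0, 0, 0, 1]
  e2 := act A ![0, 0, 1, 0]
  e3 := act A ![0, -1, 0, 0]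
  pos_mem := ⟨by rw [mink_act]; simp [mink], act_zero_pos A⟩
  tangent1 := by rw [mink_act]; simp [mink]
  tangent2 := by rw [mink_act]; simp [mink]
  tangent3 := by rw [mink_act]; simp [mink]
  unit1 := by rw [mink_act]; simp [mink]
  unit2 := by rw [mink_act]; simp [mink]
  unit3 := by rw [mink_act]; simp [mink]
  orth12 := by rw [mink_act]; simp [mink]
  orth13 := by rw [mink_act]; simp [mink]
  orth23 := by rw [mink_act]; simp [mink]
  rightHanded := by rw [det_act]; exact one_pos

/-- `G` is obtained from the frame `F` by the right-handed rotation of angle `θ` about `e1`. -/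
def Frame.IsRotation1 (θ : ℝ) (F G : Frame) : Prop :=
  G.pos = F.pos ∧ G.e1 = F.e1 ∧ G.e2 = Real.cos θ • F.e2 + Real.sin θ • F.e3 ∧
    G.e3 = Real.cos θ • F.e3 - Real.sin θ • F.e2

/-- `G` is obtained from the frame `F` by the right-handed rotation of angle `θ` about `e2`. -/
def Frame.IsRotation2 (θ : ℝ) (F G : Frame) : Prop :=
  G.pos = F.pos ∧ G.e2 = F.e2 ∧ G.e3 = Real.cos θ • F.e3 + Real.sin θ • F.e1 ∧
    G.e1 = Real.cos θ • F.e1 - Real.sin θ • F.e3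

/-- `G` is obtained from the frame `F` by (parallel) translation by the signed distance `ρ` along
the geodesic through `F.pos` oriented by `F.e1`. -/
def Frame.IsTranslation1 (ρ : ℝ) (F G : Frame) : Prop :=
  G.pos = Real.cosh ρ • F.pos + Real.sinh ρ • F.e1 ∧
    G.e1 = Real.sinh ρ • F.pos + Real.cosh ρ • F.e1 ∧ G.e2 = F.e2 ∧ G.e3 = F.e3

/-- Spin version of a one-parameter motion `R` of frames (with `R 0` the identity): the spin frame
`G` is the end point at parameter `a` of the continuous path of spin frames that starts at `F` and
lifts the path of frames given by moving the frame of `F` by `R s`. -/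
def SpinFrame.MovesTo (R : ℝ → Frame → Frame → Prop) (a : ℝ) (F G : SpinFrame) : Prop :=
  ∃ γ : ℝ → SpinFrame, Continuous γ ∧ γ 0 = F ∧ γ a = G ∧
    ∀ s, R s (SpinFrame.frame F) (SpinFrame.frame (γ s))

/-- `d = ρ + iθ` is a complex (translation) distance from the spin frame `F` to the spin frame `G`:
a translation of signed distance `ρ` along the oriented geodesic to which `F` is adapted, followed
by a rotation of angle `θ` about it, takes `F` to `G`. -/
def SpinFrame.IsComplexDistance (F G : SpinFrame) (d : ℂ) : Prop :=
  ∃ H : SpinFrame, SpinFrame.MovesTo Frame.IsTranslation1 d.re F H ∧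
    SpinFrame.MovesTo Frame.IsRotation1 d.im H G

/-! ### Spin-decorated horospheres and lambda lengths -/

/-- Parabolic elements of `SL(2, ℂ)`. -/
def IsParabolic (A : SL2) : Prop :=
  (A : Matrix (Fin 2) (Fin 2) ℂ).trace = 2 ∨ (A : Matrix (Fin 2) (Fin 2) ℂ).trace = -2

/-- `V` is a unit tangent vector field on the horosphere of `p` that is parallel, i.e. invariant
under the parabolic isometries preserving the horosphere. The tangent space of the horosphere at
`x` is `x^⊥ ∩ p^⊥`. -/
def IsUnitParallelField (p : Mink) (V : horosphere p → Mink) : Prop :=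
  (∀ x : horosphere p, mink (x : Mink) (V x) = 0 ∧ mink p (V x) = 0 ∧ mink (V x) (V x) = -1) ∧
  ∀ A : SL2, IsParabolic A → act A '' horosphere p = horosphere p →
    ∀ x y : horosphere p, (y : Mink) = act A x → V y = act A (V x)

/-- `W` is a continuous lift to spin frames of the outward frame field
`(N^out, V, N^out × V)` on the horosphere of `p`. The unit normal at `x` towards the centre is
`N^out = p - x`; the third vector is determined as frames are right-handed orthonormal. -/
def IsOutwardSpinLift (p : Mink) (V : horosphere p → Mink) (W : horosphere p → SpinFrame) : Prop :=
  Continuous W ∧ ∀ x, (SpinFrame.frame (W x)).pos = x ∧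
    (SpinFrame.frame (W x)).e1 = p - x ∧ (SpinFrame.frame (W x)).e2 = V x

/-- `W` is a continuous lift to spin frames of the inward frame field `(N^in, V, N^in × V)` on the
horosphere of `p`, where `N^in = x - p` is the unit normal at `x` away from the centre. -/
def IsInwardSpinLift (p : Mink) (V : horosphere p → Mink) (W : horosphere p → SpinFrame) : Prop :=
  Continuous W ∧ ∀ x, (SpinFrame.frame (W x)).pos = x ∧
    (SpinFrame.frame (W x)).e1 = x - p ∧ (SpinFrame.frame (W x)).e2 = V x

/-- A spin-decorated horosphere: a horosphere (given by its point of the light cone) with a pair of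
an inward and an outward spin decoration associated to each other, the inward one being obtained
from the outward one by rotation of angle `π` about the common parallel field `V`. -/
structure SpinDecoratedHorosphere where
  base : Mink
  base_mem : base ∈ lightCone
  inward : horosphere base → SpinFrame
  outward : horosphere base → SpinFrame
  exists_field : ∃ V : horosphere base → Mink, IsUnitParallelField base V ∧
    IsInwardSpinLift base V inward ∧ IsOutwardSpinLift base V outward
  associated : ∀ x, SpinFrame.MovesTo Frame.IsRotation2 Real.pi (outward x) (inward x)

/-- The centre of a spin-decorated horosphere, an ideal point in `∂𝕌 = ℂ ∪ {∞}`. -/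
noncomputable def SpinDecoratedHorosphere.centre (h : SpinDecoratedHorosphere) : OnePoint ℂ :=
  boundaryPoint h.base

/-- `d` is a complex distance from `h₁` to `h₂` (with distinct centres): the complex distance from
the inward spin frame of `h₁` at `q₁` to the outward spin frame of `h₂` at `q₂`, where `q₁`, `q₂`
are the intersection points of the two horospheres with the geodesic joining their centres. The
frame of `h₁` at `q₁` has first vector `N^in`, so it is adapted to this geodesic oriented from the
centre of `h₁` to the centre of `h₂`. -/
def IsComplexDistance (h₁ h₂ : SpinDecoratedHorosphere) (d : ℂ) : Prop :=
  ∃ (q₁ : horosphere h₁.base) (q₂ : horosphere h₂.base),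
    (q₁ : Mink) ∈ geodesic h₁.base h₂.base ∧ (q₂ : Mink) ∈ geodesic h₁.base h₂.base ∧
    SpinFrame.IsComplexDistance (h₁.inward q₁) (h₂.outward q₂) d

open Classical in
/-- The complex lambda length `λ = exp (d / 2)` from `h₁` to `h₂`, where `d` is the complex distance
from `h₁` to `h₂` (well defined modulo `4πi`); it is `0` if the centres coincide. -/
noncomputable def lambdaLength (h₁ h₂ : SpinDecoratedHorosphere) : ℂ :=
  if h₁.centre = h₂.centre then 0
  else Complex.exp (Classical.epsilon (IsComplexDistance h₁ h₂) / 2)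

/-! ### Ideal tetrahedra and shape parameters -/

/-- Four labelled ideal points are the vertices of a (nondegenerate) ideal tetrahedron, labelled
with the orientation for which the vertices `0, 3, 2` are in anticlockwise order as seen from the
vertex `1`. With `u i` the points of the unit sphere corresponding to the ideal points, the
determinant is `det (u 1 - u 0, u 2 - u 0, u 3 - u 0)`, six times the signed volume of the
tetrahedron with vertices `u i` (the ideal tetrahedron in the projective ball model). -/
def IsOrientedIdealTetrahedron (v : Fin 4 → OnePoint ℂ) : Prop :=
  (Matrix.of fun i => celestial (v i)).det < 0

/-- `z` is the shape parameter, along the edge joining the vertices `i` and `j`, of the ideal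
tetrahedron with ideal vertices `v`: an orientation-preserving isometry places the endpoints of the
edge at `0` and `∞`, and the two remaining ideal vertices at `1` and `z`, where `Im z > 0`. -/
def IsShapeParameter (v : Fin 4 → OnePoint ℂ) (i j : Fin 4) (z : ℂ) : Prop :=
  0 < z.im ∧ ∃ (A : SL2) (k l : Fin 4), ({i, j, k, l} : Finset (Fin 4)) = Finset.univ ∧
    ((moebius A (v i) = ((0 : ℂ) : OnePoint ℂ) ∧ moebius A (v j) = OnePoint.infty) ∨
      (moebius A (v i) = OnePoint.infty ∧ moebius A (v j) = ((0 : ℂ) : OnePoint ℂ))) ∧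
    moebius A (v k) = ((1 : ℂ) : OnePoint ℂ) ∧ moebius A (v l) = (z : OnePoint ℂ)

end SpinHorosphere

/-!
Right multiplication by `exp (w σ_z)` and by rotation matrices realises translations along and
rotations about the vectors of a frame, and a continuous lift to spin frames is determined by one
value. Applied to the parallel frame field of a horosphere, the latter shows that the outward spin
frames of a spin-decorated horosphere are exactly the matrices in `SL(2, ℂ)` with a fixed first
column `κ`, the spinor of the horosphere (Penrose–Rindler, Mathews); its centre is `[κ 0 : κ 1]`.
The outward spin frame of a horosphere with spinor `κ` on the geodesic to the centre of one with
spinor `μ` is then the matrix with columns `κ`, `μ / det (κ, μ)`, and the lambda length is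
`det (κ, μ)`.

A shape parameter is a cross ratio of the vertices, hence a ratio of products of determinants of
spinors. Which of the two mutually inverse cross ratios at an edge lies in the upper half plane is
decided by the orientation, because the determinant of the four light vectors `κ i κ i*` is a
negative multiple of the imaginary part of one of them. Even permutations of the vertices
carry the edge `01` to all other edges.
-/

namespace SpinHorosphere

open Matrix

theorem eq_of_forall_eq_or_eq {X Y : Type*} [TopologicalSpace X] [PreconnectedSpace X]
    [TopologicalSpace Y] [T2Space Y] {f g g' : X → Y} (hf : Continuous f) (hg : Continuous g)
    (hg' : Continuous g') (hne : ∀ x, g x ≠ g' x) (h : ∀ x, f x = g x ∨ f x = g' x) {x₀ : X}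
    (h₀ : f x₀ = g x₀) : f = g := by
  have hcompl : {x | f x = g x}ᶜ = {x | f x = g' x} := by
    ext x
    exact ⟨(h x).resolve_left, fun hx hx' => hne x (hx'.symm.trans hx)⟩
  have hclopen : IsClopen {x | f x = g x} :=
    ⟨isClosed_eq hf hg, isClosed_compl_iff.mp (hcompl ▸ isClosed_eq hf hg')⟩
  exact funext fun x => (hclopen.eq_univ ⟨x₀, h₀⟩).ge (Set.mem_univ x)

/-! ### The action on Minkowski space and on spinors -/

theorem isHermitian_toHerm (v : Mink) : (toHerm v).IsHermitian := by
  ext i j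
  fin_cases i <;> fin_cases j <;> simp [toHerm, sub_eq_add_neg]

theorem ofHerm_toHerm (v : Mink) : ofHerm (toHerm v) = v := by
  ext i
  fin_cases i <;> simp [ofHerm, toHerm] <;> ring

theorem toHerm_ofHerm {S : Matrix (Fin 2) (Fin 2) ℂ} (hS : S.IsHermitian) :
    toHerm (ofHerm S) = S := by
  have h00 := Complex.conj_eq_iff_im.mp (hS.apply 0 0)
  have h11 := Complex.conj_eq_iff_im.mp (hS.apply 1 1)
  have h01 := hS.apply 1 0
  ext i j
  fin_cases i <;> fin_cases j <;> apply Complex.ext <;>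
    simp [toHerm, ofHerm, h00, h11, ← h01] <;> ring

theorem toHerm_act (A : SL2) (v : Mink) :
    toHerm (act A v) =
      (A : Matrix (Fin 2) (Fin 2) ℂ) * toHerm v * (A : Matrix (Fin 2) (Fin 2) ℂ)ᴴ :=
  toHerm_ofHerm (isHermitian_mul_mul_conjTranspose _ (isHermitian_toHerm v))

theorem act_one (v : Mink) : act 1 v = v := by
  simp [act, ofHerm_toHerm]

theorem act_mul (A B : SL2) (v : Mink) : act (A * B) v = act A (act B v) := by
  have hmul : ((A * B : SL2) : Matrix (Fin 2) (Fin 2) ℂ) = A * B := rfl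
  rw [act, hmul, conjTranspose_mul, act, toHerm_act]
  simp only [Matrix.mul_assoc]

theorem act_inv_act (A : SL2) (v : Mink) : act A⁻¹ (act A v) = v := by
  rw [← act_mul, inv_mul_cancel, act_one]

theorem act_add (A : SL2) (u v : Mink) : act A (u + v) = act A u + act A v := by
  ext i
  fin_cases i <;> simp [act, ofHerm, toHerm, Matrix.mul_apply, Fin.sum_univ_two] <;> ring

theorem act_smul (A : SL2) (r : ℝ) (v : Mink) : act A (r • v) = r • act A v := by
  ext i
  fin_cases i <;> simp [act, ofHerm, toHerm, Matrix.mul_apply, Fin.sum_univ_two] <;> ring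

theorem act_sub (A : SL2) (u v : Mink) : act A (u - v) = act A u - act A v := by
  rw [eq_sub_iff_add_eq, ← act_add, sub_add_cancel]

theorem continuous_act_left (v : Mink) : Continuous fun A : SL2 => act A v := by
  have hmat : Continuous fun A : SL2 => (A : Matrix (Fin 2) (Fin 2) ℂ) * toHerm v *
      (A : Matrix (Fin 2) (Fin 2) ℂ)ᴴ := by fun_prop
  refine continuous_pi fun i => ?_
  have hentry (j k : Fin 2) := hmat.matrix_elem j k
  fin_cases i
  · exact Complex.continuous_re.comp ((hentry 0 0).add (hentry 1 1))
  · exact continuous_const.mul (Complex.continuous_re.comp (hentry 0 1))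
  · exact continuous_const.mul (Complex.continuous_im.comp (hentry 0 1))
  · exact Complex.continuous_re.comp ((hentry 0 0).sub (hentry 1 1))

/-- The point of the light cone with Hermitian matrix `κ κ*`, for a spinor `κ`: it gives the
horosphere described by `κ`, and its ray is the ideal point `[κ 0 : κ 1]`. -/
def lightVector (κ : Fin 2 → ℂ) : Mink := ofHerm (vecMulVec κ (star κ))

theorem toHerm_lightVector (κ : Fin 2 → ℂ) : toHerm (lightVector κ) = vecMulVec κ (star κ) := by
  refine toHerm_ofHerm ?_
  rw [IsHermitian, conjTranspose_vecMulVec, star_star]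

theorem act_lightVector (A : SL2) (κ : Fin 2 → ℂ) :
    act A (lightVector κ) = lightVector ((A : Matrix (Fin 2) (Fin 2) ℂ) *ᵥ κ) := by
  rw [act, toHerm_lightVector, mul_vecMulVec, vecMulVec_mul, ← star_mulVec, lightVector]

theorem lightVector_eq (κ : Fin 2 → ℂ) :
    lightVector κ = ![Complex.normSq (κ 0) + Complex.normSq (κ 1), 2 * (κ 0 * star (κ 1)).re,
      2 * (κ 0 * star (κ 1)).im, Complex.normSq (κ 0) - Complex.normSq (κ 1)] := by
  ext i
  fin_cases i <;> simp [lightVector, ofHerm, vecMulVec_apply, Complex.normSq_apply]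

theorem lightVector_apply_zero_pos {κ : Fin 2 → ℂ} (hκ : κ ≠ 0) : 0 < lightVector κ 0 := by
  obtain ⟨i, hi⟩ := Function.ne_iff.mp hκ
  have hpos : 0 < Complex.normSq (κ i) := Complex.normSq_pos.mpr hi
  simp only [lightVector_eq, cons_val_zero]
  fin_cases i
  · exact add_pos_of_pos_of_nonneg hpos (Complex.normSq_nonneg _)
  · exact add_pos_of_nonneg_of_pos (Complex.normSq_nonneg _) hpos

theorem lightVector_smul (c : ℂ) (κ : Fin 2 → ℂ) :
    lightVector (c • κ) = Complex.normSq c • lightVector κ := by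
  ext i
  fin_cases i <;> simp [lightVector, ofHerm, vecMulVec_apply, Complex.normSq_apply] <;> ring

/-- The `SL(2, ℂ)`-invariant symplectic form `det (κ, μ)` on spinors, which computes lambda
lengths. -/
def bracket (κ μ : Fin 2 → ℂ) : ℂ := κ 0 * μ 1 - κ 1 * μ 0

theorem bracket_swap (κ μ : Fin 2 → ℂ) : bracket κ μ = -bracket μ κ := by
  simp only [bracket]; ring

theorem bracket_smul_right (c : ℂ) (κ μ : Fin 2 → ℂ) : bracket κ (c • μ) = c * bracket κ μ := by
  simp only [bracket, Pi.smul_apply, smul_eq_mul]; ring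

theorem left_ne_zero_of_bracket_ne_zero {κ μ : Fin 2 → ℂ} (h : bracket κ μ ≠ 0) : κ ≠ 0 := by
  rintro rfl
  simp [bracket] at h

theorem right_ne_zero_of_bracket_ne_zero {κ μ : Fin 2 → ℂ} (h : bracket κ μ ≠ 0) : μ ≠ 0 := by
  rintro rfl
  simp [bracket] at h

theorem bracket_self (κ : Fin 2 → ℂ) : bracket κ κ = 0 := by
  rw [bracket, mul_comm, sub_self]

theorem bracket_star_star (κ μ : Fin 2 → ℂ) : bracket (star κ) (star μ) = star (bracket κ μ) := by
  simp [bracket]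

theorem bracket_mulVec (A : SL2) (κ μ : Fin 2 → ℂ) :
    bracket ((A : Matrix (Fin 2) (Fin 2) ℂ) *ᵥ κ) ((A : Matrix (Fin 2) (Fin 2) ℂ) *ᵥ μ) =
      bracket κ μ := by
  have hdet := A.det_coe
  rw [det_fin_two] at hdet
  simp only [bracket, mulVec_fin_two, cons_val_zero, cons_val_one]
  linear_combination (κ 0 * μ 1 - κ 1 * μ 0) * hdet

theorem det_of_tensor (κ μ : Fin 4 → Fin 2 → ℂ) :
    (of fun i => ![κ i 0 * μ i 0, κ i 0 * μ i 1, κ i 1 * μ i 0, κ i 1 * μ i 1]).det =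
      bracket (μ 0) (μ 2) * bracket (μ 1) (μ 3) * (bracket (κ 0) (κ 3) * bracket (κ 1) (κ 2)) -
      bracket (κ 0) (κ 2) * bracket (κ 1) (κ 3) *
        (bracket (μ 0) (μ 3) * bracket (μ 1) (μ 2)) := by
  simp [Matrix.det_succ_row_zero, Fin.sum_univ_succ, Fin.succAbove, bracket]
  ring

theorem det_lightVector (κ : Fin 4 → Fin 2 → ℂ) :
    (of fun i => lightVector (κ i)).det =
      -8 * (bracket (κ 0) (κ 2) * bracket (κ 1) (κ 3) *
        star (bracket (κ 0) (κ 3) * bracket (κ 1) (κ 2))).im := by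
  -- `K` expresses the Minkowski coordinates of `κ κ*` through its matrix entries.
  set K : Matrix (Fin 4) (Fin 4) ℂ :=
    !![1, 0, 0, 1; 0, 1, -Complex.I, 0; 0, 1, Complex.I, 0; 1, 0, 0, -1] with hK
  have hdetK : K.det = -4 * Complex.I := by
    simp [hK, det_succ_row_zero, Fin.sum_univ_succ, Fin.succAbove]
    ring
  have hfactor : (of fun i => lightVector (κ i)).map Complex.ofRealHom =
      (of fun i => ![κ i 0 * star (κ i) 0, κ i 0 * star (κ i) 1, κ i 1 * star (κ i) 0,
        κ i 1 * star (κ i) 1]) * K := by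
    ext i j
    fin_cases j <;> apply Complex.ext <;>
      simp [hK, lightVector_eq, Complex.normSq_apply, Matrix.mul_apply, Fin.sum_univ_succ] <;> ring
  have hdet := congrArg (Complex.re ∘ det) hfactor
  simp only [Function.comp_apply, det_mul, hdetK, det_of_tensor κ fun i => star (κ i),
    bracket_star_star, ← star_mul', ← RingHom.mapMatrix_apply, ← RingHom.map_det,
    Complex.ofRealHom_eq_coe, Complex.ofReal_re] at hdet
  rw [hdet]
  generalize bracket (κ 0) (κ 2) * bracket (κ 1) (κ 3) = x at *
  generalize bracket (κ 0) (κ 3) * bracket (κ 1) (κ 2) = y at *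
  simp
  ring

/-- The ideal point `κ 0 / κ 1` of `∂𝕌 = ℂ ∪ {∞}` with homogeneous coordinates `[κ 0 : κ 1]`. -/
noncomputable def idealPoint (κ : Fin 2 → ℂ) : OnePoint ℂ :=
  open Classical in if κ 1 = 0 then OnePoint.infty else (κ 0 / κ 1 : ℂ)

theorem idealPoint_eq_infty_iff {κ : Fin 2 → ℂ} : idealPoint κ = OnePoint.infty ↔ κ 1 = 0 := by
  simp [idealPoint]

theorem idealPoint_eq_coe_iff {κ : Fin 2 → ℂ} {z : ℂ} :
    idealPoint κ = (z : OnePoint ℂ) ↔ κ 1 ≠ 0 ∧ κ 0 = z * κ 1 := by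
  by_cases h : κ 1 = 0
  · simp [idealPoint, h]
  · simp [idealPoint, h, div_eq_iff]

theorem idealPoint_eq_iff {κ μ : Fin 2 → ℂ} (hκ : κ ≠ 0) (hμ : μ ≠ 0) :
    idealPoint κ = idealPoint μ ↔ bracket κ μ = 0 := by
  have hzero {ν : Fin 2 → ℂ} (hν : ν ≠ 0) (h1 : ν 1 = 0) : ν 0 ≠ 0 := fun h0 =>
    hν (funext (Fin.forall_fin_two.mpr ⟨h0, h1⟩))
  by_cases hκ1 : κ 1 = 0 <;> by_cases hμ1 : μ 1 = 0
  · simp [idealPoint, bracket, hκ1, hμ1]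
  · simp [idealPoint, bracket, hκ1, hμ1, hzero hκ hκ1]
  · simp [idealPoint, bracket, hκ1, hμ1, hzero hμ hμ1]
  · simp [idealPoint, bracket, hκ1, hμ1, div_eq_div_iff, sub_eq_zero, mul_comm (κ 1)]

theorem mulVec_ne_zero (A : SL2) {κ : Fin 2 → ℂ} (hκ : κ ≠ 0) :
    (A : Matrix (Fin 2) (Fin 2) ℂ) *ᵥ κ ≠ 0 := by
  rw [← mulVec_zero (A : Matrix (Fin 2) (Fin 2) ℂ)]
  exact (mulVec_injective_of_isUnit ((isUnit_iff_isUnit_det _).mpr (by simp))).ne hκ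

theorem moebius_idealPoint (A : SL2) {κ : Fin 2 → ℂ} (hκ : κ ≠ 0) :
    moebius A (idealPoint κ) = idealPoint ((A : Matrix (Fin 2) (Fin 2) ℂ) *ᵥ κ) := by
  have eq_symm_mk {ν : Fin 2 → ℂ} (hν : ν ≠ 0) :
      idealPoint ν = (OnePoint.equivProjectivization ℂ).symm (.mk ℂ ν hν) := by
    rw [OnePoint.equivProjectivization_symm_apply_mk, idealPoint, div_eq_inv_mul]
  rw [eq_symm_mk hκ, eq_symm_mk (mulVec_ne_zero A hκ), Equiv.eq_symm_apply, moebius,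
    OnePoint.equivProjectivization_smul, Equiv.apply_symm_apply]
  rfl

theorem lightVector_zero_sub_three (κ : Fin 2 → ℂ) :
    (lightVector κ 0 - lightVector κ 3 : ℂ) = 2 * (κ 1 * star (κ 1)) := by
  apply Complex.ext <;> simp [lightVector, ofHerm, vecMulVec_apply] <;> ring

theorem lightVector_one_add_two (κ : Fin 2 → ℂ) :
    (lightVector κ 1 + lightVector κ 2 * Complex.I : ℂ) = 2 * (κ 0 * star (κ 1)) := by
  apply Complex.ext <;> simp [lightVector, ofHerm, vecMulVec_apply]

theorem boundaryPoint_lightVector (κ : Fin 2 → ℂ) :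
    boundaryPoint (lightVector κ) = idealPoint κ := by
  have hsub := lightVector_zero_sub_three κ
  have hiff : lightVector κ 0 = lightVector κ 3 ↔ κ 1 = 0 := by
    rw [← Complex.ofReal_inj, ← sub_eq_zero, hsub]
    simp
  by_cases h : κ 1 = 0
  · rw [boundaryPoint, if_pos (hiff.mpr h), idealPoint, if_pos h]
  · rw [boundaryPoint, if_neg (hiff.not.mpr h), idealPoint, if_neg h, hsub,
      lightVector_one_add_two, mul_div_mul_left _ _ two_ne_zero,
      mul_div_mul_right _ _ (star_ne_zero.mpr h)]

theorem celestial_idealPoint {κ : Fin 2 → ℂ} (hκ : κ ≠ 0) :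
    celestial (idealPoint κ) = (lightVector κ 0)⁻¹ • lightVector κ := by
  have hpos := lightVector_apply_zero_pos hκ
  rw [eq_inv_smul_iff₀ hpos.ne']
  simp only [lightVector_eq, cons_val_zero] at hpos ⊢
  by_cases h : κ 1 = 0
  · rw [idealPoint, if_pos h]
    change _ • ![1, 0, 0, 1] = _
    ext i
    fin_cases i <;> simp [h]
  · have h1 : Complex.normSq (κ 1) ≠ 0 := Complex.normSq_eq_zero.not.mpr h
    have hsum : 1 + Complex.normSq (κ 0 / κ 1) =
        (Complex.normSq (κ 0) + Complex.normSq (κ 1)) / Complex.normSq (κ 1) := by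
      rw [Complex.normSq_div]
      field_simp
      ring
    rw [idealPoint, if_neg h]
    change _ • ![1, 2 * Complex.re _ / (1 + Complex.normSq _), 2 * Complex.im _ / _,
      (Complex.normSq _ - 1) / _] = _
    rw [hsum, Complex.normSq_div, Complex.div_re, Complex.div_im]
    ext i
    fin_cases i
    · simp
    all_goals
      simp
      field_simp
      try ring

/-! ### Motions of spin frames -/

theorem eq_one_or_eq_neg_one_of_act_eq {C : SL2} (hT : act C ![1, 0, 0, 0] = ![1, 0, 0, 0])
    (hZ : act C ![0, 0, 0, 1] = ![0, 0, 0, 1]) (hY : act C ![0, 0, 1, 0] = ![0, 0, 1, 0]) :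
    C = 1 ∨ C = -1 := by
  have htoHerm : toHerm ![1, 0, 0, 0] = (1 / 2 : ℂ) • (1 : Matrix (Fin 2) (Fin 2) ℂ) := by
    ext i j
    fin_cases i <;> fin_cases j <;> simp [toHerm]
  have hunitary : (C : Matrix (Fin 2) (Fin 2) ℂ)ᴴ * C = 1 := by
    have h := toHerm_act C ![1, 0, 0, 0]
    simp only [hT, htoHerm, Matrix.mul_smul, Matrix.smul_mul, Matrix.mul_one] at h
    exact mul_eq_one_comm.mp (smul_right_injective _ (by norm_num : (1 / 2 : ℂ) ≠ 0) h).symm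
  have hcomm {v : Mink} (hv : act C v = v) : toHerm v * C = C * toHerm v := by
    have h := congrArg (· * (C : Matrix (Fin 2) (Fin 2) ℂ)) (toHerm_act C v)
    simpa only [hv, Matrix.mul_assoc, hunitary, Matrix.mul_one] using h
  have h01 : C 0 1 = 0 := by
    have h : (2⁻¹ : ℂ) * C 0 1 = -(C 0 1 * 2⁻¹) := by
      simpa [toHerm, Matrix.mul_apply, Fin.sum_univ_two] using congrFun₂ (hcomm hZ) 0 1
    linear_combination h
  have h10 : C 1 0 = 0 := by
    have h : -((2⁻¹ : ℂ) * C 1 0) = C 1 0 * 2⁻¹ := by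
      simpa [toHerm, Matrix.mul_apply, Fin.sum_univ_two] using congrFun₂ (hcomm hZ) 1 0
    linear_combination -h
  have h11 : C 1 1 = C 0 0 := by
    have h : 2⁻¹ * Complex.I * C 1 1 = C 0 0 * (2⁻¹ * Complex.I) := by
      simpa [toHerm, Matrix.mul_apply, Fin.sum_univ_two] using congrFun₂ (hcomm hY) 0 1
    linear_combination -2 * Complex.I * h + (C 1 1 - C 0 0) * Complex.I_sq
  have hsq : C 0 0 ^ 2 = 1 := by
    have h := C.det_coe
    rw [det_fin_two, h01, h11] at h
    linear_combination h
  rcases eq_or_eq_neg_of_sq_eq_sq _ 1 (hsq.trans (one_pow 2).symm) with h00 | h00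
  · left
    ext i j
    fin_cases i <;> fin_cases j <;> simp [h00, h01, h10, h11]
  · right
    ext i j
    fin_cases i <;> fin_cases j <;> simp [h00, h01, h10, h11]

theorem SpinFrame.eq_or_eq_neg {A B : SpinFrame} (hpos : (frame A).pos = (frame B).pos)
    (he1 : (frame A).e1 = (frame B).e1) (he2 : (frame A).e2 = (frame B).e2) :
    A = B ∨ A = -B := by
  have hfix {v : Mink} (h : act A v = act B v) : act (B⁻¹ * A) v = v := by
    rw [act_mul, h, act_inv_act]
  rcases eq_one_or_eq_neg_one_of_act_eq (hfix hpos) (hfix he1) (hfix he2) with h | h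
  · exact Or.inl (inv_mul_eq_one.mp h).symm
  · exact Or.inr (by rw [inv_mul_eq_iff_eq_mul.mp h, mul_neg, mul_one])

theorem SpinFrame.ne_neg (A : SpinFrame) : A ≠ -A := by
  intro h
  have hentry (i j : Fin 2) : A i j = 0 :=
    self_eq_neg.mp (congrArg (fun M : SL2 => M i j) h)
  have hdet := A.det_coe
  rw [det_fin_two, hentry 0 0, hentry 0 1] at hdet
  simp at hdet

theorem SpinFrame.eq_of_continuous_lift {X : Type*} [TopologicalSpace X] [PreconnectedSpace X]
    {f g : X → SpinFrame} (hf : Continuous f) (hg : Continuous g)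
    (hpos : ∀ x, (frame (f x)).pos = (frame (g x)).pos)
    (he1 : ∀ x, (frame (f x)).e1 = (frame (g x)).e1)
    (he2 : ∀ x, (frame (f x)).e2 = (frame (g x)).e2) {x₀ : X} (h₀ : f x₀ = g x₀) : f = g := by
  have hneg : Continuous fun x => -g x := by
    simp_rw [← neg_one_mul (g _)]
    exact continuous_const.mul hg
  exact eq_of_forall_eq_or_eq hf hg hneg (fun x => ne_neg (g x))
    (fun x => eq_or_eq_neg (hpos x) (he1 x) (he2 x)) h₀

theorem SpinFrame.movesTo_iff {R : ℝ → Frame → Frame → Prop} {D : ℝ → SL2} (hD : Continuous D)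
    (hD0 : D 0 = 1)
    (hR : ∀ s (F G : SpinFrame), R s (frame F) (frame G) ↔ frame G = frame (F * D s : SL2))
    {a : ℝ} {F G : SpinFrame} : MovesTo R a F G ↔ G = F * D a := by
  have hcont : Continuous fun s => F * D s := continuous_const.mul hD
  have hstart : F * D 0 = F := by rw [hD0, mul_one]
  constructor
  · rintro ⟨γ, hγ, h0, rfl, hγR⟩
    have hframe s := (hR s F (γ s)).mp (hγR s)
    exact congrFun (eq_of_continuous_lift hγ hcont (fun s => congrArg Frame.pos (hframe s))
      (fun s => congrArg Frame.e1 (hframe s)) (fun s => congrArg Frame.e2 (hframe s))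
      (h0.trans hstart.symm)) a
  · rintro rfl
    exact ⟨fun s => F * D s, hcont, hstart, rfl, fun s => (hR s F _).mpr rfl⟩

theorem continuous_mk_SL2 {X : Type*} [TopologicalSpace X] {f : X → SL2}
    (h : ∀ i j, Continuous fun x => f x i j) : Continuous f :=
  (SpecialLinearGroup.isClosedEmbedding_val (R := ℂ)).continuous_iff.mpr (continuous_matrix h)

/-- The diagonal matrix `diag (exp w, exp (-w))`. Right multiplication by it translates a spin frame
along its first vector by `2 Re w` and rotates it about this vector by `2 Im w`. -/
noncomputable def expDiag (w : ℂ) : SL2 :=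
  ⟨!![Complex.exp w, 0; 0, Complex.exp (-w)], by simp [← Complex.exp_add]⟩

/-- The rotation matrix of angle `φ`. Right multiplication by it rotates a spin frame about its
second vector by `2 φ`. -/
noncomputable def rot (φ : ℝ) : SL2 :=
  ⟨!![(Real.cos φ : ℂ), -Real.sin φ; Real.sin φ, Real.cos φ], by
    rw [det_fin_two_of]
    exact_mod_cast by linear_combination Real.cos_sq_add_sin_sq φ⟩

/-- The upper triangular unipotent matrix with off-diagonal entry `t`. Right multiplication by it
moves a spin frame along the horosphere to whose centre its first vector points. -/
def unip (t : ℂ) : SL2 := ⟨!![1, t; 0, 1], by simp⟩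

theorem coe_expDiag (w : ℂ) : (expDiag w : Matrix (Fin 2) (Fin 2) ℂ) =
    !![Complex.exp w, 0; 0, Complex.exp (-w)] := rfl

theorem coe_rot (φ : ℝ) : (rot φ : Matrix (Fin 2) (Fin 2) ℂ) =
    !![(Real.cos φ : ℂ), -Real.sin φ; Real.sin φ, Real.cos φ] := rfl

theorem coe_unip (t : ℂ) : (unip t : Matrix (Fin 2) (Fin 2) ℂ) = !![1, t; 0, 1] := rfl

theorem expDiag_zero : expDiag 0 = 1 := by
  ext i j
  fin_cases i <;> fin_cases j <;> simp [coe_expDiag]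

theorem expDiag_add (w w' : ℂ) : expDiag (w + w') = expDiag w * expDiag w' := by
  refine Subtype.ext ?_
  change !![Complex.exp (w + w'), 0; 0, Complex.exp (-(w + w'))] =
    !![Complex.exp w, 0; 0, Complex.exp (-w)] * !![Complex.exp w', 0; 0, Complex.exp (-w')]
  simp [← Complex.exp_add, add_comm]

theorem continuous_expDiag : Continuous expDiag := by
  refine continuous_mk_SL2 fun i j => ?_
  fin_cases i <;> fin_cases j
  · exact Complex.continuous_exp
  · exact continuous_const
  · exact continuous_const
  · exact Complex.continuous_exp.comp continuous_neg

theorem rot_zero : rot 0 = 1 := by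
  ext i j
  fin_cases i <;> fin_cases j <;> simp [coe_rot]

theorem continuous_rot : Continuous rot := by
  have hcos : Continuous fun φ : ℝ => (Real.cos φ : ℂ) := by fun_prop
  have hsin : Continuous fun φ : ℝ => (Real.sin φ : ℂ) := by fun_prop
  refine continuous_mk_SL2 fun i j => ?_
  fin_cases i <;> fin_cases j
  · exact hcos
  · exact hsin.neg
  · exact hsin
  · exact hcos

theorem unip_zero : unip 0 = 1 := by
  ext i j
  fin_cases i <;> fin_cases j <;> simp [coe_unip]

theorem unip_add (s t : ℂ) : unip (s + t) = unip s * unip t := by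
  refine Subtype.ext ?_
  change !![1, s + t; 0, 1] = !![1, s; 0, 1] * !![1, t; 0, 1]
  simp [add_comm]

theorem continuous_unip : Continuous unip := by
  refine continuous_mk_SL2 fun i j => ?_
  fin_cases i <;> fin_cases j
  · exact continuous_const
  · exact continuous_id
  · exact continuous_const
  · exact continuous_const

theorem act_expDiag (w : ℂ) (v : Mink) :
    act (expDiag w) v =
      ![Real.cosh (2 * w.re) * v 0 + Real.sinh (2 * w.re) * v 3,
        Real.cos (2 * w.im) * v 1 - Real.sin (2 * w.im) * v 2,
        Real.sin (2 * w.im) * v 1 + Real.cos (2 * w.im) * v 2,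
        Real.sinh (2 * w.re) * v 0 + Real.cosh (2 * w.re) * v 3] := by
  have hexp : Real.exp w.re * Real.exp (-w.re) = 1 := by rw [← Real.exp_add]; simp
  have htrig := Real.cos_sq_add_sin_sq w.im
  have hcosh : Real.cosh (2 * w.re) = (Real.exp w.re ^ 2 + Real.exp (-w.re) ^ 2) / 2 := by
    rw [Real.cosh_eq, ← Real.exp_nat_mul, ← Real.exp_nat_mul]; simp
  have hsinh : Real.sinh (2 * w.re) = (Real.exp w.re ^ 2 - Real.exp (-w.re) ^ 2) / 2 := by
    rw [Real.sinh_eq, ← Real.exp_nat_mul, ← Real.exp_nat_mul]; simp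
  ext i
  fin_cases i <;>
    simp [act, ofHerm, toHerm, coe_expDiag, Matrix.mul_apply, Fin.sum_univ_two, Complex.exp_re,
      Complex.exp_im, hcosh, hsinh, Real.cos_two_mul', Real.sin_two_mul]
  · linear_combination (1 / 2) *
      (Real.exp w.re ^ 2 * (v 0 + v 3) + Real.exp (-w.re) ^ 2 * (v 0 - v 3)) * htrig
  · linear_combination (v 1 * (Real.cos w.im ^ 2 - Real.sin w.im ^ 2) -
      v 2 * (2 * Real.sin w.im * Real.cos w.im)) * hexp
  · linear_combination (v 2 * (Real.cos w.im ^ 2 - Real.sin w.im ^ 2) +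
      v 1 * (2 * Real.sin w.im * Real.cos w.im)) * hexp
  · linear_combination (1 / 2) *
      (Real.exp w.re ^ 2 * (v 0 + v 3) - Real.exp (-w.re) ^ 2 * (v 0 - v 3)) * htrig

theorem act_rot (φ : ℝ) (v : Mink) :
    act (rot φ) v =
      ![v 0, Real.cos (2 * φ) * v 1 + Real.sin (2 * φ) * v 3, v 2,
        Real.cos (2 * φ) * v 3 - Real.sin (2 * φ) * v 1] := by
  have htrig := Real.cos_sq_add_sin_sq φ
  ext i
  fin_cases i <;>
    simp [act, ofHerm, toHerm, coe_rot, Matrix.mul_apply, Fin.sum_univ_two, Real.cos_two_mul',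
      Real.sin_two_mul, -Complex.ofReal_cos, -Complex.ofReal_sin]
  · linear_combination v 0 * htrig
  · ring
  · linear_combination v 2 * htrig
  · ring

theorem SpinFrame.movesTo_isTranslation1_iff {ρ : ℝ} {F G : SpinFrame} :
    MovesTo Frame.IsTranslation1 ρ F G ↔ G = F * expDiag (ρ / 2) := by
  refine movesTo_iff (D := fun s : ℝ => expDiag (s / 2)) (continuous_expDiag.comp (by fun_prop))
    (by simp [expDiag_zero]) fun s F G => ?_
  simp only [Frame.IsTranslation1, Frame.ext_iff, frame, act_mul, act_expDiag, ← act_smul,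
    ← act_add]
  simp [mul_div_cancel₀]

theorem SpinFrame.movesTo_isRotation1_iff {θ : ℝ} {F G : SpinFrame} :
    MovesTo Frame.IsRotation1 θ F G ↔ G = F * expDiag (θ * Complex.I / 2) := by
  refine movesTo_iff (D := fun s : ℝ => expDiag (s * Complex.I / 2))
    (continuous_expDiag.comp (by fun_prop)) (by simp [expDiag_zero]) fun s F G => ?_
  simp only [Frame.IsRotation1, Frame.ext_iff, frame, act_mul, act_expDiag, ← act_smul,
    ← act_add, ← act_sub]
  simp [mul_div_cancel₀, -sub_self]

theorem SpinFrame.movesTo_isRotation2_iff {θ : ℝ} {F G : SpinFrame} :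
    MovesTo Frame.IsRotation2 θ F G ↔ G = F * rot (θ / 2) := by
  refine movesTo_iff (D := fun s : ℝ => rot (s / 2)) (continuous_rot.comp (by fun_prop))
    (by simp [rot_zero]) fun s F G => ?_
  simp only [Frame.IsRotation2, Frame.ext_iff, frame, act_mul, act_rot, ← act_smul,
    ← act_add, ← act_sub]
  simp [mul_div_cancel₀, and_comm, and_left_comm]

theorem SpinFrame.isComplexDistance_iff {F G : SpinFrame} {d : ℂ} :
    IsComplexDistance F G d ↔ G = F * expDiag (d / 2) := by
  simp only [IsComplexDistance, movesTo_isTranslation1_iff, movesTo_isRotation1_iff,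
    exists_eq_left]
  rw [mul_assoc, ← expDiag_add, ← add_div, Complex.re_add_im]

/-! ### Spinors of spin-decorated horospheres -/

/-- The spinor of a spin frame: its first column as a matrix in `SL(2, ℂ)`. It describes the
horosphere through the base point whose centre lies in the direction of the first vector of the
frame, together with the spin decoration on it extending the frame. -/
def SpinFrame.spinor (A : SpinFrame) : Fin 2 → ℂ :=
  (A : Matrix (Fin 2) (Fin 2) ℂ).col 0

namespace SpinFrame

theorem pos_add_e1 (A : SpinFrame) : (frame A).pos + (frame A).e1 = lightVector A.spinor := by
  have hsum : (![1, 0, 0, 0] + ![0, 0, 0, 1] : Mink) = lightVector (Pi.single 0 1) := by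
    ext i
    fin_cases i <;> simp [lightVector, ofHerm, vecMulVec_apply]
  rw [frame, ← act_add, hsum, act_lightVector, mulVec_single_one, spinor]

theorem pos_sub_e1 (A : SpinFrame) :
    (frame A).pos - (frame A).e1 = lightVector ((A : Matrix (Fin 2) (Fin 2) ℂ).col 1) := by
  have hdiff : (![1, 0, 0, 0] - ![0, 0, 0, 1] : Mink) = lightVector (Pi.single 1 1) := by
    ext i
    fin_cases i <;> simp [lightVector, ofHerm, vecMulVec_apply]
  rw [frame, ← act_sub, hdiff, act_lightVector, mulVec_single_one]

theorem spinor_mul_unip (A : SpinFrame) (t : ℂ) : spinor (A * unip t) = A.spinor := by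
  ext i
  simp [spinor, coe_unip, Matrix.mul_apply, Fin.sum_univ_two]

theorem spinor_eq_iff {A B : SpinFrame} : B.spinor = A.spinor ↔ ∃ t, B = A * unip t := by
  constructor
  · intro h
    obtain ⟨h0, h1⟩ : B 0 0 = A 0 0 ∧ B 1 0 = A 1 0 := ⟨congrFun h 0, congrFun h 1⟩
    have hA := A.det_coe
    have hB := B.det_coe
    rw [det_fin_two] at hA hB
    rw [h0, h1] at hB
    refine ⟨A 1 1 * B 0 1 - A 0 1 * B 1 1, ?_⟩
    ext i j
    fin_cases i <;> fin_cases j <;>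
      simp [coe_unip, Matrix.mul_apply, Fin.sum_univ_two, h0, h1]
    · linear_combination A 0 1 * hB - B 0 1 * hA
    · linear_combination A 1 1 * hB - B 1 1 * hA
  · rintro ⟨t, rfl⟩
    exact spinor_mul_unip A t

end SpinFrame

theorem isParabolic_conj_unip (A : SL2) (t : ℂ) : IsParabolic (A * unip t * A⁻¹) := by
  left
  change ((A : Matrix (Fin 2) (Fin 2) ℂ) * unip t * (A⁻¹ : SL2)).trace = 2
  have hinv : ((A⁻¹ : SL2) : Matrix (Fin 2) (Fin 2) ℂ) * A = 1 :=
    congrArg Subtype.val (inv_mul_cancel A)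
  rw [trace_mul_cycle, hinv, Matrix.one_mul, coe_unip, trace_fin_two_of, one_add_one_eq_two]

theorem mink_add_right (u v w : Mink) : mink u (v + w) = mink u v + mink u w := by
  simp only [mink, Pi.add_apply]; ring

theorem horosphere_lightVector_spinor (A : SpinFrame) :
    horosphere (lightVector A.spinor) =
      Set.range fun t => (SpinFrame.frame (A * unip t : SL2)).pos := by
  ext x
  constructor
  · rintro ⟨⟨hxx, -⟩, hxp⟩
    obtain ⟨y, rfl⟩ : ∃ y, x = act A y :=
      ⟨act A⁻¹ x, by rw [← act_mul, mul_inv_cancel, act_one]⟩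
    rw [← A.pos_add_e1, SpinFrame.frame, ← act_add, mink_act] at hxp
    rw [mink_act] at hxx
    have h03 : y 0 - y 3 = 1 := by simpa [mink] using hxp
    have hsq : y 0 + y 3 = 1 + y 1 ^ 2 + y 2 ^ 2 := by
      simp only [mink] at hxx
      linear_combination hxx - (y 0 + y 3) * h03
    refine ⟨y 1 + y 2 * Complex.I, ?_⟩
    change act (A * _) _ = _
    rw [act_mul]
    congr 1
    ext i
    fin_cases i <;> simp [act, ofHerm, toHerm, coe_unip, Matrix.mul_apply, Fin.sum_univ_two]
    · linarith
    · linarith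
    · ring
    · linarith
  · rintro ⟨t, rfl⟩
    have h := SpinFrame.pos_add_e1 (A * unip t)
    refine ⟨(SpinFrame.frame _).pos_mem, ?_⟩
    rw [← SpinFrame.spinor_mul_unip A t, ← h, mink_add_right, (SpinFrame.frame _).pos_mem.1,
      (SpinFrame.frame _).tangent1, add_zero]

theorem act_image_horosphere (A : SpinFrame) (t : ℂ) :
    act (A * unip t * A⁻¹) '' horosphere (lightVector A.spinor) =
      horosphere (lightVector A.spinor) := by
  rw [horosphere_lightVector_spinor, ← Set.range_comp,
    ← (Equiv.addLeft t).surjective.range_comp fun t => (SpinFrame.frame (A * unip t : SL2)).pos]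
  congr 1
  ext1 s
  simp only [Function.comp_apply, SpinFrame.frame, Equiv.coe_addLeft, ← act_mul, unip_add,
    mul_assoc, inv_mul_cancel_left]

namespace IsOutwardSpinLift

variable {p : Mink} {V : horosphere p → Mink} {W : horosphere p → SpinFrame}

theorem base_eq (hW : IsOutwardSpinLift p V W) (x : horosphere p) :
    p = lightVector (W x).spinor := by
  rw [← SpinFrame.pos_add_e1, (hW.2 x).1, (hW.2 x).2.1, add_sub_cancel]

theorem horosphere_eq (hW : IsOutwardSpinLift p V W) (x : horosphere p) :
    horosphere p = Set.range fun t => (SpinFrame.frame (W x * unip t : SL2)).pos := by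
  rw [hW.base_eq x, horosphere_lightVector_spinor]

theorem apply_eq_mul_unip (hV : IsUnitParallelField p V) (hW : IsOutwardSpinLift p V W)
    {x y : horosphere p} {t : ℂ} (hy : (y : Mink) = (SpinFrame.frame (W x * unip t : SL2)).pos) :
    W y = W x * unip t := by
  have hmem (s : ℂ) : (SpinFrame.frame (W x * unip s : SL2)).pos ∈ horosphere p :=
    (hW.horosphere_eq x).ge (Set.mem_range_self s)
  have hcont : Continuous fun s : ℂ => W x * unip s := continuous_const.mul continuous_unip
  have hposCont : Continuous fun s => (⟨_, hmem s⟩ : horosphere p) :=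
    ((continuous_act_left _).comp hcont).subtype_mk hmem
  have he1 (s : ℂ) : p - (SpinFrame.frame (W x * unip s : SL2)).pos =
      (SpinFrame.frame (W x * unip s : SL2)).e1 := by
    rw [hW.base_eq x, ← SpinFrame.spinor_mul_unip (W x) s, ← SpinFrame.pos_add_e1,
      add_sub_cancel_left]
  have he2 (s : ℂ) : V ⟨_, hmem s⟩ = (SpinFrame.frame (W x * unip s : SL2)).e2 := by
    have hinvariant : act (W x * unip s * (W x)⁻¹) '' horosphere p = horosphere p := by
      rw [hW.base_eq x, act_image_horosphere]
    rw [hV.2 _ (isParabolic_conj_unip (W x) s) hinvariant x, ← (hW.2 x).2.2]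
    · simp [SpinFrame.frame, ← act_mul]
    · simp [SpinFrame.frame, ← act_mul, ← (hW.2 x).1]
  have hstart : W ⟨_, hmem 0⟩ = W x * unip 0 := by
    simp only [unip_zero, mul_one, (hW.2 x).1]
  rw [Subtype.ext (a1 := y) (a2 := ⟨_, hmem t⟩) hy]
  exact congrFun (SpinFrame.eq_of_continuous_lift (hW.1.comp hposCont) hcont
    (fun s => (hW.2 _).1) (fun s => (hW.2 _).2.1.trans (he1 s))
    (fun s => (hW.2 _).2.2.trans (he2 s)) hstart) t

theorem mem_range_iff (hV : IsUnitParallelField p V) (hW : IsOutwardSpinLift p V W)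
    (x : horosphere p) {A : SpinFrame} : A ∈ Set.range W ↔ A.spinor = (W x).spinor := by
  rw [SpinFrame.spinor_eq_iff]
  constructor
  · rintro ⟨y, rfl⟩
    obtain ⟨t, ht⟩ := (hW.horosphere_eq x).le y.2
    exact ⟨t, apply_eq_mul_unip hV hW ht.symm⟩
  · rintro ⟨t, rfl⟩
    exact ⟨⟨_, (hW.horosphere_eq x).ge (Set.mem_range_self t)⟩, apply_eq_mul_unip hV hW rfl⟩

end IsOutwardSpinLift

theorem horosphere_nonempty {p : Mink} (hp : p ∈ lightCone) : (horosphere p).Nonempty := by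
  obtain ⟨hnull, hpos⟩ := hp
  simp only [mink] at hnull
  set r := (p 0 ^ 2)⁻¹
  have hrp : r * p 0 ^ 2 = 1 := inv_mul_cancel₀ (pow_ne_zero 2 hpos.ne')
  -- The witness lies on the geodesic from `p` to its antipode `(p 0, -p 1, -p 2, -p 3)`.
  refine ⟨![(1 + r) / 2 * p 0, (1 - r) / 2 * p 1, (1 - r) / 2 * p 2, (1 - r) / 2 * p 3],
    ⟨?_, ?_⟩, ?_⟩
  · simp only [mink, cons_val]
    linear_combination hrp + ((1 - r) / 2) ^ 2 * hnull
  · simp only [cons_val_zero]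
    positivity
  · simp only [mink, cons_val]
    linear_combination hrp + (1 - r) / 2 * hnull

namespace SpinDecoratedHorosphere

variable (h : SpinDecoratedHorosphere)

/-- The spinor of a spin-decorated horosphere: the common spinor of its outward spin frames. -/
noncomputable def spinor : Fin 2 → ℂ :=
  (h.outward ⟨_, (horosphere_nonempty h.base_mem).some_mem⟩).spinor

theorem mem_range_outward_iff {A : SpinFrame} :
    A ∈ Set.range h.outward ↔ A.spinor = h.spinor := by
  obtain ⟨V, hV, -, hW⟩ := h.exists_field
  exact hW.mem_range_iff hV _

theorem spinor_outward (x : horosphere h.base) : (h.outward x).spinor = h.spinor :=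
  h.mem_range_outward_iff.mp (Set.mem_range_self x)

theorem pos_outward (x : horosphere h.base) : (SpinFrame.frame (h.outward x)).pos = x := by
  obtain ⟨V, -, -, hW⟩ := h.exists_field
  exact (hW.2 x).1

theorem inward_eq (x : horosphere h.base) : h.inward x = h.outward x * rot (Real.pi / 2) :=
  SpinFrame.movesTo_isRotation2_iff.mp (h.associated x)

theorem base_eq : h.base = lightVector h.spinor := by
  obtain ⟨V, -, -, hW⟩ := h.exists_field
  exact hW.base_eq _

theorem centre_eq : h.centre = idealPoint h.spinor := by
  rw [centre, base_eq, boundaryPoint_lightVector]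

theorem spinor_ne_zero : h.spinor ≠ 0 := by
  intro h0
  have hpos := h.base_mem.2
  rw [base_eq, h0] at hpos
  simp [lightVector, ofHerm] at hpos

end SpinDecoratedHorosphere

/-! ### Lambda lengths -/

theorem SpinFrame.exists_col_eq {κ μ : Fin 2 → ℂ} (h : bracket κ μ = 1) :
    ∃ A : SpinFrame, A.spinor = κ ∧ (A : Matrix (Fin 2) (Fin 2) ℂ).col 1 = μ := by
  refine ⟨⟨!![κ 0, μ 0; κ 1, μ 1], ?_⟩, ?_, ?_⟩
  · rw [det_fin_two_of, ← h, bracket]; ring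
  · ext i
    fin_cases i <;> rfl
  · ext i
    fin_cases i <;> rfl

theorem SpinFrame.bracket_spinor_col_one (A : SpinFrame) :
    bracket A.spinor ((A : Matrix (Fin 2) (Fin 2) ℂ).col 1) = 1 := by
  have hdet := A.det_coe
  rw [det_fin_two] at hdet
  simp only [bracket, spinor, col_apply]
  linear_combination hdet

theorem SpinFrame.spinor_mul_rot_mul_expDiag (A : SpinFrame) (w : ℂ) :
    spinor (A * rot (Real.pi / 2) * expDiag w) =
      Complex.exp w • (A : Matrix (Fin 2) (Fin 2) ℂ).col 1 := by
  ext i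
  simp [spinor, coe_rot, coe_expDiag, Matrix.mul_apply, Fin.sum_univ_two, mul_comm]

theorem SpinFrame.col_one_mul_rot_mul_expDiag (A : SpinFrame) (w : ℂ) :
    ((A * rot (Real.pi / 2) * expDiag w : SL2) : Matrix (Fin 2) (Fin 2) ℂ).col 1 =
      -Complex.exp (-w) • A.spinor := by
  ext i
  simp [spinor, coe_rot, coe_expDiag, Matrix.mul_apply, Fin.sum_univ_two, mul_comm]

theorem SpinFrame.pos_mem_geodesic {A : SpinFrame} {κ μ : Fin 2 → ℂ} {a b : ℂ}
    (hκ : A.spinor = a • κ) (hμ : (A : Matrix (Fin 2) (Fin 2) ℂ).col 1 = b • μ) :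
    (frame A).pos ∈ geodesic (lightVector κ) (lightVector μ) := by
  refine ⟨(frame A).pos_mem, Complex.normSq a / 2, Complex.normSq b / 2, ?_⟩
  have hadd := A.pos_add_e1
  have hsub := A.pos_sub_e1
  rw [hκ, lightVector_smul] at hadd
  rw [hμ, lightVector_smul] at hsub
  linear_combination (norm := module) (1 / 2 : ℝ) • hadd + (1 / 2 : ℝ) • hsub

theorem geodesic_comm (p q : Mink) : geodesic p q = geodesic q p := by
  ext x
  simp only [geodesic, Set.mem_ofPred_eq, add_comm (_ • p)]
  rw [exists_comm]

theorem isComplexDistance_iff_exp_eq_bracket {h₁ h₂ : SpinDecoratedHorosphere} {d : ℂ} :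
    IsComplexDistance h₁ h₂ d ↔ Complex.exp (d / 2) = bracket h₁.spinor h₂.spinor := by
  simp only [IsComplexDistance, SpinFrame.isComplexDistance_iff, h₁.inward_eq]
  constructor
  · rintro ⟨q₁, q₂, -, -, h⟩
    rw [← h₂.spinor_outward q₂, h, SpinFrame.spinor_mul_rot_mul_expDiag, bracket_smul_right,
      ← h₁.spinor_outward q₁, SpinFrame.bracket_spinor_col_one, mul_one]
  · intro h
    set b := bracket h₁.spinor h₂.spinor with hb
    have hb0 : b ≠ 0 := h ▸ Complex.exp_ne_zero _
    obtain ⟨A, hA0, hA1⟩ := SpinFrame.exists_col_eq (κ := h₁.spinor) (μ := b⁻¹ • h₂.spinor)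
      (by rw [bracket_smul_right, ← hb, inv_mul_cancel₀ hb0])
    set B := A * rot (Real.pi / 2) * expDiag (d / 2) with hB
    have hB0 : SpinFrame.spinor B = h₂.spinor := by
      rw [hB, SpinFrame.spinor_mul_rot_mul_expDiag, hA1, h, smul_inv_smul₀ hb0]
    have hB1 := A.col_one_mul_rot_mul_expDiag (d / 2)
    rw [hA0] at hB1
    obtain ⟨q₁, hq₁⟩ := h₁.mem_range_outward_iff.mpr hA0
    obtain ⟨q₂, hq₂⟩ := h₂.mem_range_outward_iff.mpr hB0
    refine ⟨q₁, q₂, ?_, ?_, by rw [hq₂, hq₁]⟩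
    · rw [← h₁.pos_outward, hq₁, h₁.base_eq, h₂.base_eq]
      exact SpinFrame.pos_mem_geodesic (hA0.trans (one_smul ℂ _).symm) hA1
    · rw [← h₂.pos_outward, hq₂, h₁.base_eq, h₂.base_eq, geodesic_comm]
      exact SpinFrame.pos_mem_geodesic (hB0.trans (one_smul ℂ _).symm) hB1

theorem centre_eq_iff {h₁ h₂ : SpinDecoratedHorosphere} :
    h₁.centre = h₂.centre ↔ bracket h₁.spinor h₂.spinor = 0 := by
  rw [h₁.centre_eq, h₂.centre_eq, idealPoint_eq_iff h₁.spinor_ne_zero h₂.spinor_ne_zero]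

theorem lambdaLength_eq_bracket (h₁ h₂ : SpinDecoratedHorosphere) :
    lambdaLength h₁ h₂ = bracket h₁.spinor h₂.spinor := by
  by_cases hc : h₁.centre = h₂.centre
  · rw [lambdaLength, if_pos hc, centre_eq_iff.mp hc]
  · rw [lambdaLength, if_neg hc, ← isComplexDistance_iff_exp_eq_bracket]
    refine Classical.epsilon_spec (p := IsComplexDistance h₁ h₂)
      ⟨2 * Complex.log (bracket h₁.spinor h₂.spinor), ?_⟩
    rw [isComplexDistance_iff_exp_eq_bracket, mul_div_cancel_left₀ _ two_ne_zero,
      Complex.exp_log (centre_eq_iff.not.mp hc)]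

theorem lambdaLength_swap (h₁ h₂ : SpinDecoratedHorosphere) :
    lambdaLength h₁ h₂ = -lambdaLength h₂ h₁ := by
  rw [lambdaLength_eq_bracket, lambdaLength_eq_bracket, bracket_swap]

/-! ### Cross ratios and shape parameters -/

/-- The position of the fourth of the ideal points with homogeneous coordinates `a, b, c, d` once
the first three have been moved to `0, ∞, 1`. -/
noncomputable def crossRatio (a b c d : Fin 2 → ℂ) : ℂ :=
  bracket a d * bracket b c / (bracket a c * bracket b d)

theorem crossRatio_swap_swap (a b c d : Fin 2 → ℂ) : crossRatio b a d c = crossRatio a b c d := by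
  simp only [crossRatio, mul_comm]

theorem inv_crossRatio (a b c d : Fin 2 → ℂ) : (crossRatio a b c d)⁻¹ = crossRatio a b d c := by
  rw [crossRatio, crossRatio, inv_div]

theorem exists_mulVec_eq {a b c : Fin 2 → ℂ} (hab : bracket a b ≠ 0) (hac : bracket a c ≠ 0)
    (hbc : bracket b c ≠ 0) :
    ∃ (A : SL2) (s : ℂ), s ≠ 0 ∧ ∀ κ, (A : Matrix (Fin 2) (Fin 2) ℂ) *ᵥ κ =
      s • ![bracket b c * bracket a κ, bracket a c * bracket b κ] := by
  -- `κ ↦ [⟨b, c⟩ ⟨a, κ⟩ : ⟨a, c⟩ ⟨b, κ⟩]`, with `⟨·, ·⟩` the bracket, sends `a`, `b`, `c` to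
  -- `0`, `∞`, `1` and has determinant `⟨b, c⟩ ⟨a, c⟩ ⟨a, b⟩`.
  have hprod : bracket b c * bracket a c * bracket a b ≠ 0 := by simp [hab, hac, hbc]
  obtain ⟨s, hs⟩ := IsAlgClosed.exists_pow_nat_eq
    (bracket b c * bracket a c * bracket a b)⁻¹ two_pos
  have hs1 : s ^ 2 * (bracket b c * bracket a c * bracket a b) = 1 := by
    rw [hs, inv_mul_cancel₀ hprod]
  refine ⟨⟨!![-(s * bracket b c * a 1), s * bracket b c * a 0;
    -(s * bracket a c * b 1), s * bracket a c * b 0], ?_⟩, s, ?_, fun κ => ?_⟩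
  · rw [det_fin_two_of, ← hs1, bracket, bracket, bracket]
    ring
  · rintro rfl
    simp at hs1
  · ext i
    fin_cases i <;> simp [bracket, vecHead, vecTail] <;> ring

theorem exists_moebius_iff {a b c d : Fin 2 → ℂ} (hab : bracket a b ≠ 0)
    (hac : bracket a c ≠ 0) (hbc : bracket b c ≠ 0) (had : bracket a d ≠ 0)
    (hbd : bracket b d ≠ 0) {z : ℂ} :
    (∃ A : SL2, moebius A (idealPoint a) = (0 : ℂ) ∧ moebius A (idealPoint b) = OnePoint.infty ∧
      moebius A (idealPoint c) = (1 : ℂ) ∧ moebius A (idealPoint d) = z) ↔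
    z = crossRatio a b c d := by
  have ha := left_ne_zero_of_bracket_ne_zero hab
  have hb := right_ne_zero_of_bracket_ne_zero hab
  have hc := right_ne_zero_of_bracket_ne_zero hac
  have hd := right_ne_zero_of_bracket_ne_zero had
  simp only [moebius_idealPoint _ ha, moebius_idealPoint _ hb, moebius_idealPoint _ hc,
    moebius_idealPoint _ hd, idealPoint_eq_infty_iff, idealPoint_eq_coe_iff]
  constructor
  · rintro ⟨A, ⟨-, ha0⟩, hb1, ⟨-, hc0⟩, ⟨-, hd0⟩⟩
    rw [crossRatio, eq_div_iff (mul_ne_zero hac hbd)]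
    rw [← bracket_mulVec A a c, ← bracket_mulVec A b d, ← bracket_mulVec A a d,
      ← bracket_mulVec A b c]
    simp only [bracket, ha0, hb1, hc0, hd0]
    ring
  · rintro rfl
    obtain ⟨A, s, hs, hA⟩ := exists_mulVec_eq hab hac hbc
    refine ⟨A, ⟨?_, ?_⟩, ?_, ⟨?_, ?_⟩, ?_, ?_⟩ <;> simp only [hA]
    · simp [bracket_swap b a, hs, hab, hac]
    · simp [bracket_self]
    · simp [bracket_self]
    · simp [hs, hac, hbc]
    · simp [mul_comm (bracket b c)]
    · simp [hs, hac, hbd]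
    · simp only [Pi.smul_apply, cons_val_zero, cons_val_one, smul_eq_mul, crossRatio]
      field_simp

theorem im_div_pos_iff {x y : ℂ} : 0 < (x / y).im ↔ 0 < (x * star y).im := by
  by_cases hy : y = 0
  · simp [hy]
  · rw [div_eq_mul_inv, Complex.inv_def, ← mul_assoc, Complex.im_mul_ofReal]
    exact mul_pos_iff_of_pos_right (inv_pos.mpr (Complex.normSq_pos.mpr hy))

theorem isOrientedIdealTetrahedron_idealPoint_iff {κ : Fin 4 → Fin 2 → ℂ} (hκ : ∀ i, κ i ≠ 0) :
    IsOrientedIdealTetrahedron (fun i => idealPoint (κ i)) ↔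
      0 < (crossRatio (κ 0) (κ 1) (κ 3) (κ 2)).im := by
  have hdet : (of fun i => celestial (idealPoint (κ i))).det =
      (∏ i, (lightVector (κ i) 0)⁻¹) * (of fun i => lightVector (κ i)).det := by
    simp only [celestial_idealPoint (hκ _), ← det_mul_column]
    rfl
  have hpos : 0 < ∏ i, (lightVector (κ i) 0)⁻¹ :=
    Finset.prod_pos fun i _ => inv_pos.mpr (lightVector_apply_zero_pos (hκ i))
  rw [IsOrientedIdealTetrahedron, hdet, ← smul_eq_mul, smul_neg_iff_of_pos_left hpos,
    det_lightVector, ← smul_eq_mul, smul_neg_iff_of_neg_left (by norm_num), crossRatio,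
    im_div_pos_iff]

theorem IsOrientedIdealTetrahedron.injective {v : Fin 4 → OnePoint ℂ}
    (hv : IsOrientedIdealTetrahedron v) : Function.Injective v := by
  intro i j hij
  by_contra hne
  exact hv.ne (det_zero_of_row_eq hne (congrArg celestial hij))

theorem IsOrientedIdealTetrahedron.comp_perm {v : Fin 4 → OnePoint ℂ}
    (hv : IsOrientedIdealTetrahedron v) {σ : Equiv.Perm (Fin 4)} (hσ : Equiv.Perm.sign σ = 1) :
    IsOrientedIdealTetrahedron (v ∘ σ) := by
  have hdet := det_permute σ (of fun i => celestial (v i))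
  rw [hσ, Units.val_one, Int.cast_one, one_mul] at hdet
  exact hdet.trans_lt hv

theorem isShapeParameter_comp_perm (v : Fin 4 → OnePoint ℂ) (σ : Equiv.Perm (Fin 4))
    (i j : Fin 4) (z : ℂ) :
    IsShapeParameter (v ∘ σ) i j z ↔ IsShapeParameter v (σ i) (σ j) z := by
  have hcover (k l : Fin 4) : ({σ i, σ j, σ k, σ l} : Finset (Fin 4)) = Finset.univ ↔
      ({i, j, k, l} : Finset (Fin 4)) = Finset.univ := by
    rw [← (Finset.image_injective σ.injective).eq_iff (a := {i, j, k, l}), Finset.image_univ_equiv]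
    simp only [Finset.image_insert, Finset.image_singleton]
  refine and_congr_right fun _ => exists_congr fun A => (σ.surjective.exists.trans <|
    exists_congr fun k => σ.surjective.exists.trans <| exists_congr fun l => ?_).symm
  simp only [hcover, Function.comp_apply]

theorem isShapeParameter_zero_one_iff {κ : Fin 4 → Fin 2 → ℂ} (hκ : ∀ i, κ i ≠ 0)
    (hv : IsOrientedIdealTetrahedron fun i => idealPoint (κ i)) {z : ℂ} :
    IsShapeParameter (fun i => idealPoint (κ i)) 0 1 z ↔
      z = crossRatio (κ 0) (κ 1) (κ 3) (κ 2) := by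
  have hbracket {i j : Fin 4} (hij : i ≠ j) : bracket (κ i) (κ j) ≠ 0 := fun h =>
    hij (hv.injective ((idealPoint_eq_iff (hκ i) (hκ j)).mpr h))
  have hmoebius (i j k l : Fin 4) (hij : i ≠ j := by decide) (hik : i ≠ k := by decide)
      (hjk : j ≠ k := by decide) (hil : i ≠ l := by decide) (hjl : j ≠ l := by decide) :=
    exists_moebius_iff (hbracket hij) (hbracket hik) (hbracket hjk) (hbracket hil)
      (hbracket hjl) (z := z)
  have him := (isOrientedIdealTetrahedron_idealPoint_iff hκ).mp hv
  constructor
  · rintro ⟨hz, A, k, l, hkl, h01, hk, hl⟩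
    have hkl' : k = 3 ∧ l = 2 ∨ k = 2 ∧ l = 3 := by
      clear h01 hk hl
      decide +revert
    have hz' : z = crossRatio (κ 0) (κ 1) (κ 3) (κ 2) ∨
        z = crossRatio (κ 0) (κ 1) (κ 2) (κ 3) := by
      obtain ⟨rfl, rfl⟩ | ⟨rfl, rfl⟩ := hkl' <;> obtain ⟨h0, h1⟩ | ⟨h1, h0⟩ := h01
      · exact .inl ((hmoebius 0 1 3 2).mp ⟨A, h0, h1, hk, hl⟩)
      · rw [← crossRatio_swap_swap (κ 0) (κ 1) (κ 2) (κ 3)]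
        exact .inr ((hmoebius 1 0 3 2).mp ⟨A, h0, h1, hk, hl⟩)
      · exact .inr ((hmoebius 0 1 2 3).mp ⟨A, h0, h1, hk, hl⟩)
      · rw [← crossRatio_swap_swap (κ 0) (κ 1) (κ 3) (κ 2)]
        exact .inl ((hmoebius 1 0 2 3).mp ⟨A, h0, h1, hk, hl⟩)
    refine hz'.resolve_right fun hinv => hz.not_ge ?_
    rw [hinv, ← inv_crossRatio, Complex.inv_im]
    exact div_nonpos_of_nonpos_of_nonneg (neg_nonpos.mpr him.le) (Complex.normSq_nonneg _)
  · rintro rfl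
    obtain ⟨A, h0, h1, h3, h2⟩ := (hmoebius 0 1 3 2).mpr rfl
    exact ⟨him, A, 3, 2, by decide, .inl ⟨h0, h1⟩, h3, h2⟩

theorem isShapeParameter_centre_iff {h : Fin 4 → SpinDecoratedHorosphere}
    (hv : IsOrientedIdealTetrahedron fun i => (h i).centre) {i j k l : Fin 4}
    (heven : ∃ σ : Equiv.Perm (Fin 4), Equiv.Perm.sign σ = 1 ∧ ⇑σ = ![i, j, k, l]) {z : ℂ} :
    IsShapeParameter (fun i => (h i).centre) i j z ↔
      z = lambdaLength (h i) (h k) * lambdaLength (h j) (h l) /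
        (lambdaLength (h i) (h l) * lambdaLength (h j) (h k)) := by
  obtain ⟨σ, hsign, hσ⟩ := heven
  obtain ⟨rfl, rfl, rfl, rfl⟩ : σ 0 = i ∧ σ 1 = j ∧ σ 2 = k ∧ σ 3 = l := by simp [hσ]
  simp only [SpinDecoratedHorosphere.centre_eq, lambdaLength_eq_bracket] at hv ⊢
  rw [← isShapeParameter_comp_perm]
  exact isShapeParameter_zero_one_iff (κ := fun i => (h (σ i)).spinor)
    (fun i => (h (σ i)).spinor_ne_zero) (hv.comp_perm hsign)

end SpinHorosphere

open SpinHorosphere in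
theorem mainTheorem5 (v : Fin 4 → OnePoint ℂ)
    (hv : SpinHorosphere.IsOrientedIdealTetrahedron v)
    (h : Fin 4 → SpinHorosphere.SpinDecoratedHorosphere) (hc : ∀ i, (h i).centre = v i)
    (lam : Fin 4 → Fin 4 → ℂ) (hlam : ∀ i j, lam i j = SpinHorosphere.lambdaLength (h i) (h j)) :
    (∀ z : ℂ, SpinHorosphere.IsShapeParameter v 0 1 z ↔
      z = lam 0 2 * lam 1 3 / (lam 0 3 * lam 1 2)) ∧
    (∀ z : ℂ, SpinHorosphere.IsShapeParameter v 2 3 z ↔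
      z = lam 0 2 * lam 1 3 / (lam 0 3 * lam 1 2)) ∧
    (∀ z : ℂ, SpinHorosphere.IsShapeParameter v 0 2 z ↔
      z = -(lam 0 3 * lam 1 2 / (lam 0 1 * lam 2 3))) ∧
    (∀ z : ℂ, SpinHorosphere.IsShapeParameter v 1 3 z ↔
      z = -(lam 0 3 * lam 1 2 / (lam 0 1 * lam 2 3))) ∧
    (∀ z : ℂ, SpinHorosphere.IsShapeParameter v 0 3 z ↔
      z = lam 0 1 * lam 2 3 / (lam 0 2 * lam 1 3)) ∧
    (∀ z : ℂ, SpinHorosphere.IsShapeParameter v 1 2 z ↔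
      z = lam 0 1 * lam 2 3 / (lam 0 2 * lam 1 3)) := by
  obtain rfl : v = fun i => (h i).centre := funext fun i => (hc i).symm
  have edge (i j k l : Fin 4) (heven : ∃ σ : Equiv.Perm (Fin 4),
      Equiv.Perm.sign σ = 1 ∧ ⇑σ = ![i, j, k, l] := by decide) (z : ℂ) :
      IsShapeParameter (fun i => (h i).centre) i j z ↔
        z = lam i k * lam j l / (lam i l * lam j k) := by
    simpa only [hlam] using isShapeParameter_centre_iff hv heven
  have swap (i j : Fin 4) : lam i j = -lam j i := by
    rw [hlam, hlam, lambdaLength_swap]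
  refine ⟨fun z => ?_, fun z => ?_, fun z => ?_, fun z => ?_, fun z => ?_, fun z => ?_⟩
  · exact edge 0 1 2 3 (z := z)
  · rw [edge 2 3 0 1, swap 2 0, swap 3 1, swap 2 1, swap 3 0]; ring_nf
  · rw [edge 0 2 3 1, swap 2 1]; ring_nf
  · rw [edge 1 3 2 0, swap 3 0, swap 1 0, swap 3 2]; ring_nf
  · rw [edge 0 3 1 2, swap 3 2, swap 3 1]; ring_nf
  · rw [edge 1 2 0 3, swap 1 0, swap 2 0]; ring_nf
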